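/- Let $\omega=\{0,1,2,\dots\}$. For equivalence relations $E,F$ on $\omega$, say that $E$ is (computably) finitarily reducible to $F$ if there is a computable function $f:\omega^{<\omega}\to\omega^{<\omega}$ which maps every $n$-tuple $(x_0,\dots,x_{n-1})$, for every $n$, to an $n$-tuple $(y_0,\dots,y_{n-1})$ such that for all $i,j<n$ $$x_i\mathrel{E}x_j\iff y_i\mathrel{F}y_j .$$ For a Turing degree $\mathbf d$, a $\mathbf d$-computable reduction from $E$ to $F$ is a total function $g:\omega\to\omega$, computable from an oracle of degree $\mathbf d$, such that $x\mathrel{E}y\iff g(x)\mathrel{F}g(y)$ for all $x,y\in\omega$. For every Turing degree $\mathbf d$, there exist equivalence relations $E$ and $F$ on $\omega$ such that $E$ is finitarily reducible to $F$ (via a computable function), but there is no $\mathbf d$-computable reduction from $E$ to $F$. -/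

import Mathlib

/-- `f : List ℕ → List ℕ` is a finitary reduction from `E` to `F`: it maps each `n`-tuple to an
`n`-tuple (for all `n` simultaneously), so that `x i E x j` if and only if `y i F y j`. -/
def IsFinitaryReduction (E F : Setoid ℕ) (f : List ℕ → List ℕ) : Prop :=
  ∀ x : List ℕ, ∃ h : (f x).length = x.length, ∀ i j : Fin x.length,
    E.r (x.get i) (x.get j) ↔ F.r ((f x).get (i.cast h.symm)) ((f x).get (j.cast h.symm))

/-- `E` is (computably) finitarily reducible to `F`. Computability of a single function on all
finite tuples expresses that the `n`-ary reductions are computable uniformly in `n`. -/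
def FinitarilyReducible (E F : Setoid ℕ) : Prop :=
  ∃ f : List ℕ → List ℕ, Computable f ∧ IsFinitaryReduction E F f

/-- A total function `g` is `d`-computable if it is computable from an oracle of degree `d`
(it does not matter which one). Degrees of subsets of `ℕ` are those of the (total)
characteristic functions. -/
def DegreeComputable (d : TuringDegree) (g : ℕ → ℕ) : Prop :=
  ∃ o : ℕ →. ℕ, toAntisymmetrization TuringReducible o = d ∧ ComputableIn {o} g

/-- `E` is `d`-computably reducible to `F`. -/
def DegreeReducible (d : TuringDegree) (E F : Setoid ℕ) : Prop :=
  ∃ g : ℕ → ℕ, DegreeComputable d g ∧ ∀ x y : ℕ, E.r x y ↔ F.r (g x) (g y)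

/-! Only countably many functions are `d`-computable, so some `A` is the preimage of a finite set
under none of them. Let `E` have classes `A` and its complement, and let `F` be a disjoint union of
copies of `E` restricted to each finite tuple. Sending a tuple to its own copy is computable without
knowing `A`, yet every `F`-class is finite. A reduction `g` would make `A` the preimage of the
finite class of `g a`, for any `a ∈ A`. -/

/-- The partial functions obtained from the oracles in `O` by at most `n` nested applications of
the closure operations of `Nat.RecursiveIn`. -/
def recursiveInStage (O : Set (ℕ →. ℕ)) : ℕ → Set (ℕ →. ℕ)
  | 0 => {fun _ => 0, fun n => Part.some n.succ, fun n => Part.some n.unpair.1,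
      fun n => Part.some n.unpair.2} ∪ O
  | n + 1 =>
    recursiveInStage O n ∪
    Set.image2 (fun f h n => (Nat.pair <$> f n <*> h n)) (recursiveInStage O n)
      (recursiveInStage O n) ∪
    Set.image2 (fun f h n => h n >>= f) (recursiveInStage O n) (recursiveInStage O n) ∪
    Set.image2 (fun f h p =>
        let (a, n) := Nat.unpair p
        n.rec (f a) fun y IH => do
          let i ← IH
          h (Nat.pair a (Nat.pair y i))) (recursiveInStage O n) (recursiveInStage O n) ∪
    (fun (f : ℕ →. ℕ) a => Nat.rfind fun n => (fun m => m = 0) <$> f (Nat.pair a n)) ''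
      recursiveInStage O n

theorem recursiveInStage_countable {O : Set (ℕ →. ℕ)} (hO : O.Countable) (n : ℕ) :
    (recursiveInStage O n).Countable := by
  induction n with
  | zero => exact ((((Set.countable_singleton _).insert _).insert _).insert _).union hO
  | succ n ih =>
    exact (((ih.union (ih.image2 ih _)).union (ih.image2 ih _)).union (ih.image2 ih _)).union
      (ih.image _)

theorem recursiveInStage_mono (O : Set (ℕ →. ℕ)) : Monotone (recursiveInStage O) :=
  monotone_nat_of_le_succ fun _ _ hf => .inl (.inl (.inl (.inl hf)))

theorem Nat.RecursiveIn.exists_mem_stage {O : Set (ℕ →. ℕ)} {f : ℕ →. ℕ}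
    (hf : Nat.RecursiveIn O f) : ∃ n, f ∈ recursiveInStage O n := by
  have lift {f h : ℕ →. ℕ} (hf : ∃ n, f ∈ recursiveInStage O n)
      (hh : ∃ n, h ∈ recursiveInStage O n) :
      ∃ n, f ∈ recursiveInStage O n ∧ h ∈ recursiveInStage O n := by
    obtain ⟨m, hm⟩ := hf
    obtain ⟨n, hn⟩ := hh
    exact ⟨max m n, recursiveInStage_mono O (le_max_left m n) hm,
      recursiveInStage_mono O (le_max_right m n) hn⟩
  induction hf with
  | zero => exact ⟨0, .inl (.inl rfl)⟩
  | succ => exact ⟨0, .inl (.inr (.inl rfl))⟩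
  | left => exact ⟨0, .inl (.inr (.inr (.inl rfl)))⟩
  | right => exact ⟨0, .inl (.inr (.inr (.inr rfl)))⟩
  | oracle g hg => exact ⟨0, .inr hg⟩
  | pair _ _ ihf ihh =>
    obtain ⟨n, hf, hh⟩ := lift ihf ihh
    exact ⟨n + 1, .inl (.inl (.inl (.inr ⟨_, hf, _, hh, rfl⟩)))⟩
  | comp _ _ ihf ihh =>
    obtain ⟨n, hf, hh⟩ := lift ihf ihh
    exact ⟨n + 1, .inl (.inl (.inr ⟨_, hf, _, hh, rfl⟩))⟩
  | prec _ _ ihf ihh =>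
    obtain ⟨n, hf, hh⟩ := lift ihf ihh
    exact ⟨n + 1, .inl (.inr ⟨_, hf, _, hh, rfl⟩)⟩
  | rfind _ ihf =>
    obtain ⟨n, hf⟩ := ihf
    exact ⟨n + 1, .inr ⟨_, hf, rfl⟩⟩

theorem Nat.RecursiveIn.countable {O : Set (ℕ →. ℕ)} (hO : O.Countable) :
    {f | Nat.RecursiveIn O f}.Countable :=
  (Set.countable_iUnion (recursiveInStage_countable hO)).mono fun _ hf =>
    Set.mem_iUnion.2 hf.exists_mem_stage

/-- Only countably many total functions are computable from an oracle of a given degree. -/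
theorem DegreeComputable.countable (d : TuringDegree) : {g | DegreeComputable d g}.Countable := by
  obtain ⟨o, rfl⟩ := Quotient.exists_rep d
  refine Set.MapsTo.countable_of_injOn (f := fun (g : ℕ → ℕ) => (g : ℕ →. ℕ)) ?_
    (fun g _ h _ hgh => funext fun n => Part.some_injective (congrFun hgh n))
    (Nat.RecursiveIn.countable (Set.countable_singleton o))
  rintro g ⟨o', ho', hg⟩
  have hoo : TuringReducible o' o := (Quotient.exact ho').1
  exact RecursiveIn.iff_nat.1 (hg.recursiveIn.subst (by simpa using hoo))

/-- Pairs `(g, S)` are countable in number, while subsets of `ℕ` are not, by Cantor. -/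
theorem exists_set_ne_preimage_finset {G : Set (ℕ → ℕ)} (hG : G.Countable) :
    ∃ A : Set ℕ, ∀ g ∈ G, ∀ S : Finset ℕ, A ≠ g ⁻¹' S := by
  have hc : (Set.image2 (fun (g : ℕ → ℕ) (S : Finset ℕ) => g ⁻¹' (S : Set ℕ)) G
      Set.univ).Countable := hG.image2 Set.countable_univ _
  obtain ⟨A, hA⟩ : ∃ A, A ∉ Set.image2 (fun (g : ℕ → ℕ) (S : Finset ℕ) => g ⁻¹' (S : Set ℕ)) G
      Set.univ := by
    by_contra! h
    have : Countable (Set ℕ) := Set.countable_univ_iff.1 (hc.mono fun A _ => h A)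
    obtain ⟨e, he⟩ := exists_injective_nat (Set ℕ)
    exact Function.cantor_injective e he
  exact ⟨A, fun g hg S h => hA ⟨g, hg, S, trivial, h.symm⟩⟩

/-- The equivalence relation whose classes are `A` and its complement. -/
def memSetoid (A : Set ℕ) : Setoid ℕ := Setoid.ker (· ∈ A)

/-- The number `Nat.pair c i` stands for the `i`-th entry in a private copy of the tuple with
code `c`. -/
def blockTuple (x : List ℕ) : List ℕ :=
  (List.range x.length).map (Nat.pair (Encodable.encode x))

theorem computable_blockTuple : Computable blockTuple :=
  (Primrec.list_map (Primrec.list_range.comp Primrec.list_length)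
    (Primrec₂.natPair.comp₂ (Primrec.encode.comp Primrec.fst).to₂ Primrec.snd.to₂)).to_comp

open Classical in
/-- An invariant of `Nat.pair c i`: the tuple, and the `memSetoid A`-class of its `i`-th entry. -/
noncomputable def blockClass (A : Set ℕ) (y : ℕ) : ℕ × (Prop ⊕ ℕ) :=
  (y.unpair.1, if h : y.unpair.2 < (Denumerable.ofNat (List ℕ) y.unpair.1).length then
    .inl ((Denumerable.ofNat (List ℕ) y.unpair.1)[y.unpair.2] ∈ A) else .inr y.unpair.2)

/-- The disjoint union of copies of the restrictions of `memSetoid A` to all finite tuples. -/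
noncomputable def blockSetoid (A : Set ℕ) : Setoid ℕ := Setoid.ker (blockClass A)

theorem blockClass_pair_encode (A : Set ℕ) (x : List ℕ) (i : ℕ) (hi : i < x.length) :
    blockClass A (Nat.pair (Encodable.encode x) i) = (Encodable.encode x, .inl (x[i] ∈ A)) := by
  simp [blockClass, hi]

theorem isFinitaryReduction_blockTuple (A : Set ℕ) :
    IsFinitaryReduction (memSetoid A) (blockSetoid A) blockTuple := by
  intro x
  refine ⟨by simp [blockTuple], fun i j => ?_⟩
  have key (k : Fin x.length) (h : x.length = (blockTuple x).length) :
      blockClass A ((blockTuple x).get (k.cast h)) = (Encodable.encode x, .inl (x.get k ∈ A)) := by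
    refine .trans (congrArg (blockClass A) ?_) (blockClass_pair_encode A x k k.isLt)
    simp only [blockTuple, List.get_eq_getElem, List.getElem_map, List.getElem_range]
    rfl
  change (x.get i ∈ A) = (x.get j ∈ A) ↔ blockClass A _ = blockClass A _
  rw [key, key]
  simp

/-- A class stays inside one copy, which has finitely many genuine entries; each index beyond the
tuple's length is alone in its class. -/
theorem finite_blockSetoid_class (A : Set ℕ) (y : ℕ) :
    {z | (blockSetoid A).r z y}.Finite := by
  refine ((Set.finite_lt_nat (max (Denumerable.ofNat (List ℕ) y.unpair.1).length
    (y.unpair.2 + 1))).image (Nat.pair y.unpair.1)).subset fun z hz => ?_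
  have hz : blockClass A z = blockClass A y := hz
  have h1 : z.unpair.1 = y.unpair.1 := congrArg (fun p => p.1) hz
  refine ⟨z.unpair.2, ?_, by rw [← h1, Nat.pair_unpair]⟩
  have h2 := congrArg (fun p => p.2) hz
  simp only [Set.mem_ofPred_eq, lt_max_iff]
  by_contra! h
  have hz' : ¬ z.unpair.2 < (Denumerable.ofNat (List ℕ) z.unpair.1).length := by
    rw [h1]; exact h.1.not_gt
  simp only [blockClass, dif_neg hz'] at h2
  split_ifs at h2
  have := Sum.inr_injective h2
  omega

theorem mainTheorem12 (d : TuringDegree) :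
    ∃ E F : Setoid ℕ, FinitarilyReducible E F ∧ ¬ DegreeReducible d E F := by
  obtain ⟨A, hA⟩ := exists_set_ne_preimage_finset (DegreeComputable.countable d)
  refine ⟨memSetoid A, blockSetoid A,
    ⟨blockTuple, computable_blockTuple, isFinitaryReduction_blockTuple A⟩, ?_⟩
  rintro ⟨g, hg, hred⟩
  -- The choice of `A` with `S = ∅` already excludes `A = ∅`.
  obtain ⟨a, ha⟩ : A.Nonempty := by
    rw [Set.nonempty_iff_ne_empty]
    simpa using hA g hg ∅
  refine hA g hg (finite_blockSetoid_class A (g a)).toFinset ?_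
  ext x
  have h : (x ∈ A) = (a ∈ A) ↔ (blockSetoid A).r (g x) (g a) := hred x a
  simpa [ha] using h
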